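/- Let $k$ be a field of characteristic $0$ that is henselian with respect to a discrete valuation $v$, with perfect residue field $k_0$. Let $k^s$ be a separable closure of $k$, $\Gamma_k=\mathrm{Gal}(k^s/k)$, let $\Gamma_k^t$ be the maximal tame quotient of $\Gamma_k$ and $I^t\lhd\Gamma_k^t$ its inertia subgroup, so that $\Gamma_k^t/I^t=\Gamma_{k_0}$. Fix a continuous section of $\Gamma_k^t\to\Gamma_{k_0}$ and a topological generator $q_0$ of $I^t$. Let $G$ be a finite group with centre $C$, put $\bar G=G/C$, and let $f:Y\to\mathbb P^1_{k^s}$ be a $G$-cover, i.e. a finite Galois cover of smooth projective connected curves over $k^s$ with Galois group $G$, whose branch locus $S$ is $\Gamma_k$-invariant. Let $U=\mathbb P^1_{k^s}-S$, let $U_k=\mathbb P^1_k-S_k$ be its model over $k$, and let $\Phi:\pi_1(U)\to G$ be the surjection corresponding to $f$. Fix a continuous section $s:\Gamma_k\to\pi_1(U_k)$ of the natural projection (for instance the one given by a $k$-rational base point of $U$). Assume that $k$ is a field of moduli of $f$: for every $\sigma\in\Gamma_k$ there is $h_\sigma\in G$ with $\Phi(s(\sigma)\gamma s(\sigma)^{-1})=h_\sigma\Phi(\gamma)h_\sigma^{-1}$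 for all $\gamma\in\pi_1(U)$. Let $\bar\phi:\Gamma_k\to\bar G$, $\sigma\mapsto h_\sigma C$, be the resulting homomorphism, and let $\omega\in H^2(k,C)$ be the f.o.d.-obstruction of $f$, i.e. the class of the $2$-cocycle $(\sigma,\tau)\mapsto h_\sigma h_\tau h_{\sigma\tau}^{-1}$ (with $h_\sigma$ chosen to depend continuously on $\sigma$), where $C$ is a constant $\Gamma_k$-module. Assume that the order of $C$ is prime to the characteristic of $k_0$ and that $\bar\phi$ is at most tamely ramified at $v$, so that $\bar\phi$ factors through $\Gamma_k^t$. Let $r_v:H^2(k,C)\to H^1(k_0,C(-1))$, with $C(-1)=\mathrm{Hom}(I^t,C)$, be the residue map, obtained from $H^2(k,C)\cong H^2(\Gamma_k^t,C)$ and the Hochschild–Serre spectral sequence of $1\to I^t\to\Gamma_k^t\to\Gamma_{k_0}\to1$: a class represented by a continuous $2$-cocycle $c$ of $\Gamma_k^t$ that is trivial on $I^t\times I^t$ is sent to the class of $\sigma\mapsto\bigl(q\mapsto c(q,\sigma)\,c(\sigma,\sigma^{-1}q\sigma)^{-1}\bigr)$, where $\Gamma_{k_0}$ is regarded as a subgroup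 of $\Gamma_k^t$ via the chosen section. If the order of $\bar\phi(q_0)$ in $\bar G$ is prime to the order of $C$, then $r_v(\omega)=0$. -/

import Mathlib

noncomputable section

namespace TameCover

/-- The centre of a group, as a commutative group. -/
instance centerCommGroup (G : Type*) [Group G] : CommGroup (Subgroup.center G) where
  mul_comm x y := Subtype.ext (Subgroup.mem_center_iff.1 y.2 x)

/-! ### Continuous cohomology of a topological group with discrete coefficients

Coefficient groups are written multiplicatively and carry the discrete topology, so that a continuous
cochain is the same thing as a locally constant one. -/

section Cohomology

variable {Γ : Type*} [Group Γ] [TopologicalSpace Γ]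

section DegreeOne

variable {A : Type*} [CommGroup A] (ρ : Γ →* MulAut A)

/-- Continuous `1`-cocycles with values in the discrete module `A`, on which `Γ` acts through `ρ`. -/
def Z1 : Subgroup (Γ → A) where
  carrier := {z | IsLocallyConstant z ∧ ∀ σ τ, z (σ * τ) = z σ * ρ σ (z τ)}
  one_mem' := ⟨IsLocallyConstant.const 1, by simp⟩
  mul_mem' := by
    rintro x y ⟨hx, hx'⟩ ⟨hy, hy'⟩
    refine ⟨hx.mul hy, fun σ τ => ?_⟩
    simp only [Pi.mul_apply, hx', hy', map_mul]
    exact mul_mul_mul_comm _ _ _ _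
  inv_mem' := by
    rintro x ⟨hx, hx'⟩
    refine ⟨hx.inv, fun σ τ => ?_⟩
    simp only [Pi.inv_apply, hx', map_inv, mul_inv]

/-- `1`-coboundaries `σ ↦ σ(a) / a`. -/
def B1 : Subgroup (Γ → A) where
  carrier := {z | ∃ a : A, ∀ σ, z σ = ρ σ a / a}
  one_mem' := ⟨1, by simp⟩
  mul_mem' := by
    rintro x y ⟨a, ha⟩ ⟨b, hb⟩
    exact ⟨a * b, fun σ => by simp only [Pi.mul_apply, ha, hb, map_mul, mul_div_mul_comm]⟩
  inv_mem' := by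
    rintro x ⟨a, ha⟩
    exact ⟨a⁻¹, fun σ => by simp only [Pi.inv_apply, ha, map_inv, inv_div_inv, inv_div]⟩

/-- First continuous cohomology group of `Γ` with values in the discrete module `A`. -/
abbrev H1 : Type _ := Z1 ρ ⧸ (B1 ρ).subgroupOf (Z1 ρ)

end DegreeOne

section DegreeTwo

variable (Γ) (A : Type*) [CommGroup A]

/-- Continuous `2`-cocycles with values in the discrete group `A` with trivial `Γ`-action. -/
def Z2 : Subgroup (Γ × Γ → A) where
  carrier := {c | IsLocallyConstant c ∧
    ∀ σ τ υ, c (τ, υ) * c (σ, τ * υ) = c (σ * τ, υ) * c (σ, τ)}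
  one_mem' := ⟨IsLocallyConstant.const 1, by simp⟩
  mul_mem' := by
    rintro x y ⟨hx, hx'⟩ ⟨hy, hy'⟩
    refine ⟨hx.mul hy, fun σ τ υ => ?_⟩
    simp only [Pi.mul_apply]
    rw [mul_mul_mul_comm, hx', hy', mul_mul_mul_comm]
  inv_mem' := by
    rintro x ⟨hx, hx'⟩
    refine ⟨hx.inv, fun σ τ υ => ?_⟩
    simp only [Pi.inv_apply]
    rw [← mul_inv, hx', mul_inv]

/-- `2`-coboundaries `(σ, τ) ↦ u(σ) u(τ) / u(στ)` of continuous `1`-cochains `u`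
(trivial action). -/
def B2 : Subgroup (Γ × Γ → A) where
  carrier := {c | ∃ u : Γ → A, IsLocallyConstant u ∧ ∀ σ τ, c (σ, τ) = u σ * u τ / u (σ * τ)}
  one_mem' := ⟨1, IsLocallyConstant.const 1, by simp⟩
  mul_mem' := by
    rintro x y ⟨a, ha, ha'⟩ ⟨b, hb, hb'⟩
    refine ⟨a * b, ha.mul hb, fun σ τ => ?_⟩
    simp only [Pi.mul_apply, ha', hb', mul_div_mul_comm, mul_mul_mul_comm]
  inv_mem' := by
    rintro x ⟨a, ha, ha'⟩
    refine ⟨a⁻¹, ha.inv, fun σ τ => ?_⟩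
    simp only [Pi.inv_apply, ha', div_eq_mul_inv, mul_inv, inv_inv]

/-- Second continuous cohomology group of `Γ` with values in the discrete group `A` with trivial
`Γ`-action. -/
abbrev H2 : Type _ := Z2 Γ A ⧸ (B2 Γ A).subgroupOf (Z2 Γ A)

end DegreeTwo

section Inflation

variable {Δ : Type*} [Group Δ] [TopologicalSpace Δ] (A : Type*) [CommGroup A]

/-- Pullback of `2`-cocycles along a continuous homomorphism. -/
def Z2.pullback (f : Γ →* Δ) (hf : Continuous f) : Z2 Δ A →* Z2 Γ A where
  toFun c := ⟨fun p => c.1 (f p.1, f p.2),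
    c.2.1.comp_continuous ((hf.comp continuous_fst).prodMk (hf.comp continuous_snd)),
    fun σ τ υ => by simpa only [map_mul] using c.2.2 (f σ) (f τ) (f υ)⟩
  map_one' := rfl
  map_mul' _ _ := rfl

/-- Pullback `H²(Δ, A) → H²(Γ, A)` along a continuous homomorphism `Γ → Δ`. -/
def H2.pullback (f : Γ →* Δ) (hf : Continuous f) : H2 Δ A →* H2 Γ A :=
  QuotientGroup.map _ _ (Z2.pullback A f hf) (by
    rintro c ⟨u, hu, hu'⟩
    refine ⟨u ∘ f, hu.comp_continuous hf, fun σ τ => ?_⟩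
    exact (hu' (f σ) (f τ)).trans (by simp only [Function.comp_apply, map_mul]))

end Inflation

section Residue

variable (N : Subgroup Γ) (A : Type*) [CommGroup A]

/-- The group `Hom(N, A)` of continuous homomorphisms from `N` to the discrete group `A`. -/
def ContHom : Subgroup (N →* A) where
  carrier := {η | IsLocallyConstant η}
  one_mem' := IsLocallyConstant.const 1
  mul_mem' := by
    intro x y hx hy
    exact IsLocallyConstant.mul hx hy
  inv_mem' := by
    intro x hx
    exact IsLocallyConstant.inv hx

variable [IsTopologicalGroup Γ] [N.Normal]

/-- The action of `Γ` on `Hom(N, A)` (trivial action on `A`) coming from conjugation on the normal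
subgroup `N`, that is `(g • η)(q) = η(g⁻¹ q g)`. -/
def conjAction : Γ →* MulAut (ContHom N A) where
  toFun g :=
    { toFun := fun η => ⟨η.1.comp (MulAut.conjNormal g⁻¹).toMonoidHom, by
        refine IsLocallyConstant.comp_continuous (g := η.1) η.2 ?_
        refine Continuous.subtype_mk ?_ _
        exact (continuous_const.mul continuous_subtype_val).mul continuous_const⟩
      invFun := fun η => ⟨η.1.comp (MulAut.conjNormal g).toMonoidHom, by
        refine IsLocallyConstant.comp_continuous (g := η.1) η.2 ?_
        refine Continuous.subtype_mk ?_ _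
        exact (continuous_const.mul continuous_subtype_val).mul continuous_const⟩
      left_inv := fun η => by ext q; simp
      right_inv := fun η => by ext q; simp
      map_mul' := fun η θ => by ext q; simp }
  map_one' := by ext η q; simp
  map_mul' g h := by ext η q; simp

variable {A} {Q : Type*} [Group Q] [TopologicalSpace Q]

/-- The edge map `H²(Γ, A) ⇀ H¹(Q, Hom(N, A))` of the Hochschild--Serre spectral sequence of the
group extension `1 → N → Γ → Q → 1`, with a section `r : Q → Γ`. It is defined on the classes that
restrict to zero on `N`; such a class is represented by a cocycle `c` that is trivial on `N × N`,
and it is sent to the class of `σ ↦ (q ↦ c(q, σ) / c(σ, σ⁻¹qσ))`. (If `c` is normalized and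
`c(g, h)` only depends on `g` and on the class of `h` modulo `N`, this is `σ ↦ (q ↦ c(q, σ))`.) -/
def IsEdge (r : Q →* Γ) (α : H2 Γ A) (β : H1 ((conjAction N A).comp r)) : Prop :=
  ∃ c : Z2 Γ A, (QuotientGroup.mk c : H2 Γ A) = α ∧ (∀ m n : N, c.1 (m, n) = 1) ∧
    ∃ z : Z1 ((conjAction N A).comp r), (QuotientGroup.mk z : H1 _) = β ∧
      ∀ (σ : Q) (q : N), (z.1 σ).1 q =
        c.1 (q, r σ) / c.1 (r σ, (r σ)⁻¹ * q * r σ)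

end Residue

end Cohomology

/-! ### Obstruction of a central embedding problem -/

section Embedding

variable {Γ : Type*} [Group Γ] [TopologicalSpace Γ] [IsTopologicalGroup Γ] {G : Type*} [Group G]

/-- The cocycle `(σ, τ) ↦ h_σ h_τ h_{στ}⁻¹`, where `h_σ` is a lift of `φ(σ)` to `G`. -/
def liftingCocycle (φ : Γ →* G ⧸ Subgroup.center G) (hφ : IsLocallyConstant φ) :
    Z2 Γ (Subgroup.center G) :=
  ⟨fun p => ⟨(φ p.1).out * (φ p.2).out * (φ (p.1 * p.2)).out⁻¹, by
      rw [← QuotientGroup.eq_one_iff]; simp⟩, by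
    refine ⟨?_, fun σ τ υ => ?_⟩
    · have h1 : IsLocallyConstant fun p : Γ × Γ => (φ p.1, φ p.2) :=
        (hφ.comp_continuous continuous_fst).prodMk (hφ.comp_continuous continuous_snd)
      have h2 := h1.comp fun x : (G ⧸ Subgroup.center G) × (G ⧸ Subgroup.center G) =>
        x.1.out * x.2.out * (x.1 * x.2).out⁻¹
      refine IsLocallyConstant.desc _ (Subtype.val : Subgroup.center G → G) ?_
        Subtype.val_injective
      convert h2 using 1
      ext p
      simp
    · have key (x y : G) : (φ σ).out * (φ τ).out * (φ (σ * τ)).out⁻¹ ∈ Subgroup.center G := by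
        rw [← QuotientGroup.eq_one_iff]; simp
      have h2 : (φ τ).out * (φ υ).out * (φ (τ * υ)).out⁻¹ ∈ Subgroup.center G := by
        rw [← QuotientGroup.eq_one_iff]; simp
      rw [Subgroup.mem_center_iff] at h2
      apply Subtype.ext
      simp only [Subgroup.coe_mul]
      have e := h2 (φ σ).out
      calc _ = ((φ τ).out * (φ υ).out * (φ (τ * υ)).out⁻¹ * (φ σ).out) * (φ (τ * υ)).out *
              (φ (σ * (τ * υ))).out⁻¹ := by group
        _ = (φ σ).out * (φ τ).out * (φ υ).out * (φ (σ * τ * υ)).out⁻¹ := by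
            rw [← e, mul_assoc σ]; group
        _ = ((φ σ).out * (φ τ).out * (φ (σ * τ)).out⁻¹) * ((φ (σ * τ)).out * (φ υ).out *
              (φ (σ * τ * υ)).out⁻¹) := by group
        _ = _ := by
            have h3 := key 1 1
            rw [Subgroup.mem_center_iff] at h3
            exact (h3 _).symm⟩

/-- The class in `H²(Γ, C)`, `C` the centre of `G`, obstructing the existence of a lift of
`φ : Γ → G/C` to a homomorphism `Γ → G`. -/
def liftingObstruction (φ : Γ →* G ⧸ Subgroup.center G) (hφ : IsLocallyConstant φ) :
    H2 Γ (Subgroup.center G) :=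
  QuotientGroup.mk (liftingCocycle φ hφ)

end Embedding

/-! ### Inertia groups over a henselian discretely valued field -/

section Henselian

open IsLocalRing
open scoped Pointwise

/-- A domain with a finite group action is local if its ring of invariants is henselian. -/
theorem isLocalRing_of_invariant {A B H : Type*} [CommRing A] [HenselianLocalRing A] [CommRing B]
    [IsDomain B] [Algebra A B] [Group H] [Finite H] [MulSemiringAction H B] [SMulCommClass H A B]
    [Algebra.IsInvariant A B H] : IsLocalRing B := by
  classical
  have := Fintype.ofFinite H
  have hint : Algebra.IsIntegral A B := Algebra.IsInvariant.isIntegral A B H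
  have hcomap (I : Ideal B) [I.IsMaximal] : I.comap (algebraMap A B) = maximalIdeal A :=
    IsLocalRing.eq_maximalIdeal (Ideal.isMaximal_comap_of_isIntegral_of_isMaximal I)
  obtain ⟨Q, hQ⟩ := Ideal.exists_maximal B
  refine IsLocalRing.of_unique_max_ideal ⟨Q, hQ, fun Q' (hQ' : Q'.IsMaximal) => ?_⟩
  by_contra hne
  have horb (I : Ideal B) (hI : I.IsMaximal) : ∃ g : H, I = g • Q :=
    Algebra.IsInvariant.exists_smul_of_under_eq A B H Q I
      ((hcomap Q).trans (hcomap I).symm)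
  have hmax (g : H) (I : Ideal B) (hI : I.IsMaximal) : (g • I).IsMaximal := by
    rw [Ideal.pointwise_smul_eq_comap]
    exact Ideal.comap_isMaximal_of_equiv (MulSemiringAction.toRingEquiv H B g).symm
  let T : Finset (Ideal B) := (Finset.univ.image fun g : H => g • Q).erase Q
  have hT (I : Ideal B) : I ∈ T ↔ I ≠ Q ∧ I.IsMaximal := by
    simp only [T, Finset.mem_erase, Finset.mem_image, Finset.mem_univ, true_and]
    constructor
    · rintro ⟨h, g, rfl⟩
      exact ⟨h, hmax g Q hQ⟩
    · rintro ⟨h, h'⟩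
      obtain ⟨g, hg⟩ := horb I h'
      exact ⟨h, g, hg.symm⟩
  have htop : Q ⊔ ⨅ I ∈ T, I = ⊤ := Ideal.sup_iInf_eq_top fun I hI =>
    hQ.coprime_of_ne ((hT I).1 hI).2 ((hT I).1 hI).1.symm
  obtain ⟨q, hq, x₀, hx₀, hsum⟩ := Submodule.mem_sup.1 ((Ideal.eq_top_iff_one _).1 htop)
  have hx₀T (I : Ideal B) (hI : I ∈ T) : x₀ ∈ I := by
    simp only [Submodule.mem_iInf] at hx₀
    exact hx₀ I hI
  let D := MulAction.stabilizer H Q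
  let x : B := ∏ d : D, (d : H) • x₀
  have hxD (d : H) (hd : d ∈ D) : d • x = x := by
    simp only [x, Finset.smul_prod', smul_smul]
    exact Fintype.prod_equiv (Equiv.mulLeft (⟨d, hd⟩ : D)) _ _ fun _ => rfl
  have hxQ : x - 1 ∈ Q := by
    rw [← Ideal.Quotient.eq, map_one, map_prod]
    refine Finset.prod_eq_one fun d _ => ?_
    rw [← map_one (Ideal.Quotient.mk Q), Ideal.Quotient.eq]
    have h1 : x₀ - 1 = -q := by rw [← hsum]; ring
    have h2 : x₀ - 1 ∈ Q := h1 ▸ Q.neg_mem hq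
    have h3 := Ideal.smul_mem_pointwise_smul (d : H) _ _ h2
    rw [show (d : H) • Q = Q from d.2, smul_sub, smul_one] at h3
    exact h3
  have hxT (I : Ideal B) (hI : I ∈ T) : x ∈ I := by
    have h1 : x = ((1 : D) : H) • x₀ * ∏ d ∈ Finset.univ.erase (1 : D), (d : H) • x₀ :=
      (Finset.mul_prod_erase _ _ (Finset.mem_univ _)).symm
    rw [h1]
    refine I.mul_mem_right _ ?_
    simpa using hx₀T I hI
  have hgx (g : H) (hg : g • x ≠ x) : g • x ∈ Q := by
    have h1 : g⁻¹ • Q ∈ T := by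
      refine (hT _).2 ⟨fun h => hg (hxD g ?_), hmax _ _ hQ⟩
      exact inv_mem_iff.1 (show g⁻¹ ∈ D from h)
    have h2 := Ideal.smul_mem_pointwise_smul g _ _ (hxT _ h1)
    rwa [smul_inv_smul] at h2
  let s : Finset B := Finset.univ.image fun g : H => g • x
  have hxs : x ∈ s := Finset.mem_image.2 ⟨1, Finset.mem_univ _, one_smul _ _⟩
  let F : Polynomial B := ∏ y ∈ s, (Polynomial.X - Polynomial.C y)
  have hFmonic : F.Monic := Polynomial.monic_prod_of_monic _ _ fun y _ => Polynomial.monic_X_sub_C y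
  have hFinv (g : H) : g • F = F := by
    simp only [F, Finset.smul_prod', smul_sub, Polynomial.smul_X, Polynomial.smul_C]
    refine Finset.prod_nbij (fun y => g • y) ?_ (fun _ _ _ _ h => MulAction.injective g h) ?_
      fun _ _ => rfl
    · intro y hy
      obtain ⟨h, -, rfl⟩ := Finset.mem_image.1 hy
      exact Finset.mem_image.2 ⟨g * h, Finset.mem_univ _, mul_smul _ _ _⟩
    · intro y hy
      obtain ⟨h, -, rfl⟩ := Finset.mem_image.1 hy
      refine ⟨(g⁻¹ * h) • x, Finset.mem_image.2 ⟨_, Finset.mem_univ _, rfl⟩, ?_⟩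
      simp [mul_smul]
  have hlift : F ∈ Polynomial.lifts (algebraMap A B) := by
    rw [Polynomial.lifts_iff_coeff_lifts]
    intro n
    obtain ⟨a, ha⟩ := Algebra.IsInvariant.isInvariant (A := A) (G := H) (F.coeff n) fun g => by
      rw [← Polynomial.coeff_smul, hFinv]
    exact ⟨a, ha⟩
  obtain ⟨f, hfF, -, hf⟩ := Polynomial.lifts_and_natDegree_eq_and_monic hlift hFmonic
  have hmem (a : A) : a ∈ maximalIdeal A ↔ algebraMap A B a ∈ Q := by
    rw [← hcomap Q, Ideal.mem_comap]
  have heval (a : A) : algebraMap A B (f.eval a) = ∏ y ∈ s, (algebraMap A B a - y) := by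
    rw [← Polynomial.eval_map_apply, hfF, Polynomial.eval_prod]
    simp
  have h0 : f.eval 1 ∈ maximalIdeal A := by
    rw [hmem, heval, ← Finset.mul_prod_erase _ _ hxs]
    refine Q.mul_mem_right _ ?_
    rw [map_one, ← neg_sub]
    exact Q.neg_mem hxQ
  have h1 : IsUnit (f.derivative.eval 1) := by
    by_contra hu
    have h2 : f.derivative.eval 1 ∈ maximalIdeal A := hu
    rw [hmem, ← Polynomial.eval_map_apply, ← Polynomial.derivative_map, hfF, map_one,
      show F = (Polynomial.X - Polynomial.C x) * ∏ y ∈ s.erase x, (Polynomial.X - Polynomial.C y)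
        from (Finset.mul_prod_erase _ _ hxs).symm, Polynomial.derivative_mul] at h2
    simp only [Polynomial.derivative_sub, Polynomial.derivative_X, Polynomial.derivative_C,
      sub_zero, one_mul, Polynomial.eval_add, Polynomial.eval_mul, Polynomial.eval_sub,
      Polynomial.eval_X, Polynomial.eval_C, Polynomial.eval_prod] at h2
    have h3 : ∏ y ∈ s.erase x, (1 - y) ∈ Q := by
      refine (Ideal.add_mem_iff_left Q (Q.mul_mem_right _ ?_)).1 h2
      rw [← neg_sub]
      exact Q.neg_mem hxQ
    obtain ⟨y, hy, hyQ⟩ := (hQ.isPrime.prod_mem_iff).1 h3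
    obtain ⟨hyx, hys⟩ := Finset.mem_erase.1 hy
    obtain ⟨g, -, rfl⟩ := Finset.mem_image.1 hys
    exact hQ.ne_top ((Ideal.eq_top_iff_one _).2
      ((Submodule.sub_mem_iff_left Q (hgx g hyx)).1 hyQ))
  obtain ⟨a, ha, ha1⟩ := HenselianLocalRing.is_henselian f hf 1 h0 h1
  have h2 : ∏ y ∈ s, (algebraMap A B a - y) = 0 := by rw [← heval, ha.eq_zero, map_zero]
  obtain ⟨y, hy, hy0⟩ := Finset.prod_eq_zero_iff.1 h2
  obtain ⟨g, -, rfl⟩ := Finset.mem_image.1 hy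
  have hxa : x = algebraMap A B a := by
    have h3 := congrArg (g⁻¹ • ·) (sub_eq_zero.1 hy0)
    simpa using h3.symm
  have h3 : x ∈ Q' := hxT Q' ((hT Q').2 ⟨hne, hQ'⟩)
  rw [hxa, ← Ideal.mem_comap, hcomap Q', hmem, ← hxa] at h3
  exact hQ.ne_top ((Ideal.eq_top_iff_one _).2 ((Submodule.sub_mem_iff_right Q h3).1 hxQ))

/-- The integral closure of a henselian normal ring in a Galois extension of its fraction field is
local. -/
theorem isLocalRing_integralClosure (O k K : Type*) [CommRing O] [IsDomain O]
    [IsIntegrallyClosed O] [HenselianLocalRing O] [Field k] [Algebra O k] [IsFractionRing O k]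
    [Field K] [Algebra k K] [Algebra O K] [IsScalarTower O k K] [IsGalois k K] :
    IsLocalRing (integralClosure O K) := by
  refine IsLocalRing.of_isUnit_or_isUnit_one_sub_self fun b => ?_
  let L₀ : FiniteGaloisIntermediateField k K := FiniteGaloisIntermediateField.adjoin k {(b : K)}
  let L : IntermediateField k K := L₀.toIntermediateField
  have : FiniteDimensional k L := L₀.finiteDimensional
  have : IsGalois k L := L₀.isGalois
  have hbL : (b : K) ∈ L := FiniteGaloisIntermediateField.subset_adjoin k _ rfl
  have hinv : Algebra.IsInvariant O (integralClosure O L) Gal(L/k) := ⟨fun y hy => by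
    have h1 : (y : L) ∈ Set.range (algebraMap k L) :=
      (IsGalois.mem_range_algebraMap_iff_fixed (y : L)).2 fun g => congrArg Subtype.val (hy g)
    obtain ⟨a, ha⟩ := h1
    have h2 : IsIntegral O a := by
      rw [← isIntegral_algebraMap_iff (algebraMap k L).injective, ha]
      exact y.2
    obtain ⟨c, hc⟩ := IsIntegrallyClosed.isIntegral_iff.1 h2
    refine ⟨c, Subtype.ext ?_⟩
    rw [← ha, ← hc]
    exact IsScalarTower.algebraMap_apply O k L c⟩
  have hloc : IsLocalRing (integralClosure O L) :=
    isLocalRing_of_invariant (A := O) (H := Gal(L/k))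
  let i : L →ₐ[O] K := L.val.restrictScalars O
  let j : integralClosure O L →ₐ[O] integralClosure O K :=
    (i.comp (integralClosure O L).val).codRestrict _ fun y => y.2.map i
  let b' : integralClosure O L := ⟨⟨b, hbL⟩, by
    rw [mem_integralClosure_iff, ← isIntegral_algHom_iff i i.injective]
    exact b.2⟩
  have hb' : j b' = b := rfl
  rcases IsLocalRing.isUnit_or_isUnit_one_sub_self b' with h | h
  · left
    simpa only [hb'] using h.map j
  · right
    simpa only [map_sub, map_one, hb'] using h.map j


variable (O k K : Type*) [CommRing O] [IsDomain O] [IsDiscreteValuationRing O]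
  [HenselianLocalRing O] [Field k] [Algebra O k] [IsFractionRing O k] [Field K] [Algebra k K]
  [Algebra O K] [IsScalarTower O k K] [IsSepClosure k K]

/-- The integral closure of `O` in the separable closure `K` of `k`, i.e. the valuation ring of the
unique extension to `K` of the valuation of `k` with valuation ring `O`. -/
@[nolint unusedArguments]
def SepInt (O k K : Type*) [CommRing O] [Field k] [Field K] [Algebra k K] [Algebra O K] : Type _ :=
  integralClosure O K

instance : CommRing (SepInt O k K) := inferInstanceAs (CommRing (integralClosure O K))

instance : IsDomain (SepInt O k K) := inferInstanceAs (IsDomain (integralClosure O K))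

instance : Algebra O (SepInt O k K) := inferInstanceAs (Algebra O (integralClosure O K))

instance : Algebra (SepInt O k K) K := inferInstanceAs (Algebra (integralClosure O K) K)

instance : IsScalarTower O (SepInt O k K) K :=
  inferInstanceAs (IsScalarTower O (integralClosure O K) K)

instance : Algebra.IsIntegral O (SepInt O k K) :=
  inferInstanceAs (Algebra.IsIntegral O (integralClosure O K))

instance : IsLocalRing (SepInt O k K) := isLocalRing_integralClosure O k K

theorem SepInt.injective : Function.Injective (algebraMap (SepInt O k K) K) :=
  Subtype.val_injective

instance : FaithfulSMul O (SepInt O k K) := by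
  rw [faithfulSMul_iff_algebraMap_injective]
  refine Function.Injective.of_comp (f := algebraMap (SepInt O k K) K) ?_
  rw [← RingHom.coe_comp, ← IsScalarTower.algebraMap_eq, IsScalarTower.algebraMap_eq O k K,
    RingHom.coe_comp]
  exact (algebraMap k K).injective.comp (IsFractionRing.injective O k)

instance : IsLocalHom (algebraMap O (SepInt O k K)) := inferInstance

/-- The absolute Galois group `Γ_{k₀}` of the (perfect) residue field `k₀` of `O`. The residue field
of `K` serves as separable closure of `k₀`. -/
abbrev ResGal : Type _ := Gal(ResidueField (SepInt O k K)/ResidueField O)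

/-- The action of an automorphism of `K` on the valuation ring of `K`. -/
def intAut (σ : Gal(K/k)) : SepInt O k K ≃ₐ[O] SepInt O k K :=
  (σ.restrictScalars O).mapIntegralClosure

@[simp]
theorem algebraMap_intAut (σ : Gal(K/k)) (x : SepInt O k K) :
    algebraMap (SepInt O k K) K (intAut O k K σ x) = σ (algebraMap (SepInt O k K) K x) := rfl

/-- The reduction map `Γ_k → Γ_{k₀}`. -/
def reduction : Gal(K/k) →* ResGal O k K where
  toFun σ := ResidueField.mapAlgEquiv' (intAut O k K σ)
  map_one' := by
    ext x
    obtain ⟨x, rfl⟩ := residue_surjective x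
    rfl
  map_mul' σ τ := by
    ext x
    obtain ⟨x, rfl⟩ := residue_surjective x
    rfl

/-- The inertia group `I ⊆ Γ_k`. -/
abbrev inertia : Subgroup (Gal(K/k)) := (reduction O k K).ker

theorem intAut_mem (σ : Gal(K/k)) {x : SepInt O k K} (hx : x ∈ maximalIdeal (SepInt O k K)) :
    intAut O k K σ x ∈ maximalIdeal (SepInt O k K) := by
  simpa [mem_maximalIdeal, mem_nonunits_iff] using hx

/-- The wild inertia group: all `σ ∈ Γ_k` such that `σ(x)/x ≡ 1` modulo the maximal ideal
for all `x ≠ 0` in `K`. -/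
def wildInertia : Subgroup (Gal(K/k)) where
  carrier := {σ | ∀ x : K, ∃ y ∈ maximalIdeal (SepInt O k K), σ x = x * (1 + algebraMap (SepInt O k K) K y)}
  one_mem' x := ⟨0, zero_mem _, by simp⟩
  mul_mem' := by
    intro σ τ hσ hτ x
    obtain ⟨y, hy, hy'⟩ := hτ x
    obtain ⟨w, hw, hw'⟩ := hσ x
    refine ⟨w + intAut O k K σ y + w * intAut O k K σ y,
      add_mem (add_mem hw (intAut_mem O k K σ hy)) (Ideal.mul_mem_right _ _ hw), ?_⟩
    simp only [AlgEquiv.mul_apply, hy', map_mul, hw', map_add, map_one, algebraMap_intAut]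
    ring
  inv_mem' := by
    intro σ hσ x
    obtain ⟨y, hy, hy'⟩ := hσ (σ⁻¹ x)
    have h1 : σ (σ⁻¹ x) = x := σ.apply_symm_apply x
    rw [h1] at hy'
    have hu : IsUnit (1 + y) := by
      by_contra h
      have h2 : (1 + y) - y ∈ maximalIdeal (SepInt O k K) := sub_mem h hy
      rw [add_sub_cancel_right] at h2
      exact (Ideal.ne_top_iff_one _).1 (maximalIdeal.isMaximal _).ne_top h2
    obtain ⟨w, hw⟩ := hu.exists_right_inv
    refine ⟨w - 1, ?_, ?_⟩
    · have h3 : w - 1 = -(y * w) := by linear_combination hw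
      rw [h3]
      exact neg_mem (Ideal.mul_mem_right _ _ hy)
    · have h4 : (1 + algebraMap (SepInt O k K) K y) * algebraMap (SepInt O k K) K w = 1 := by
        simpa using congrArg (algebraMap (SepInt O k K) K) hw
      conv_rhs => rw [hy']
      rw [map_sub, map_one, add_sub_cancel, mul_assoc, h4, mul_one]

instance : (wildInertia O k K).Normal where
  conj_mem := by
    intro σ hσ τ x
    obtain ⟨y, hy, hy'⟩ := hσ (τ⁻¹ x)
    refine ⟨intAut O k K τ y, intAut_mem O k K τ hy, ?_⟩
    have h1 : τ (τ⁻¹ x) = x := τ.apply_symm_apply x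
    simp only [AlgEquiv.mul_apply, hy', map_mul, map_add, map_one, h1, algebraMap_intAut]

theorem wildInertia_le_inertia : wildInertia O k K ≤ inertia O k K := by
  intro σ hσ
  rw [MonoidHom.mem_ker]
  ext x
  obtain ⟨x, rfl⟩ := residue_surjective x
  obtain ⟨y, hy, hy'⟩ := hσ (algebraMap _ K x)
  change residue _ (intAut O k K σ x) = residue _ x
  have h : intAut O k K σ x = x * (1 + y) := SepInt.injective O k K (by
    simpa [algebraMap_intAut] using hy')
  rw [h, map_mul, map_add, (residue_eq_zero_iff y).2 hy, map_one, add_zero, mul_one]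

/-- The Galois group `Γ_kᵗ` of the maximal tamely ramified extension of `k`. -/
abbrev TameGal : Type _ := Gal(K/k) ⧸ wildInertia O k K

/-- The reduction map `Γ_kᵗ → Γ_{k₀}`. -/
def tameReduction : TameGal O k K →* ResGal O k K :=
  QuotientGroup.lift _ (reduction O k K) (wildInertia_le_inertia O k K)

/-- The tame inertia group `Iᵗ ⊆ Γ_kᵗ`. -/
abbrev tameInertia : Subgroup (TameGal O k K) := (tameReduction O k K).ker

/-- Inflation `H²(Γ_kᵗ, C) → H²(k, C)`, for a constant module `C`. -/
def tameInflation (C : Type*) [CommGroup C] : H2 (TameGal O k K) C →* H2 (Gal(K/k)) C :=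
  H2.pullback C (QuotientGroup.mk' (wildInertia O k K)) continuous_quotient_mk'

section ResidueMap

variable {O k K} {C : Type*} [CommGroup C]

/-- The module `C(-1) = Hom(Iᵗ, C)`. A section `r` of `Γ_kᵗ → Γ_{k₀}` identifies `Γ_kᵗ` with the
semidirect product of `Iᵗ` and `Γ_{k₀}`, and `Γ_{k₀}` acts by conjugation on `Iᵗ`. -/
abbrev twistAction (C : Type*) [CommGroup C] (r : ResGal O k K →* TameGal O k K) :
    ResGal O k K →* MulAut (ContHom (tameInertia O k K) C) :=
  (conjAction (tameInertia O k K) C).comp r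

/-- `β` is the residue of `ω`: this is the graph of the residue map
`r_v : H²(k, C) → H¹(k₀, C(-1))`, which is obtained from the identification of `H²(k, C)` with
`H²(Γ_kᵗ, C)` by inflation and from the Hochschild--Serre edge map for `1 → Iᵗ → Γ_kᵗ → Γ_{k₀} → 1`. -/
def IsResidue (r : ResGal O k K →* TameGal O k K) (ω : H2 (Gal(K/k)) C) (β : H1 (twistAction C r)) :
    Prop :=
  ∃ α : H2 (TameGal O k K) C, tameInflation O k K C α = ω ∧ IsEdge (tameInertia O k K) r α β

/-- The residue map `r_v : H²(k, C) → H¹(k₀, C(-1))`: the value at `ω` is the class `β` with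
`IsResidue r ω β`. (If the order of `C` is finite and invertible in `k₀`, there is exactly one such
`β` for every `ω`; without such a `β`, the value is unspecified.) -/
def residueMap (r : ResGal O k K →* TameGal O k K) (ω : H2 (Gal(K/k)) C) : H1 (twistAction C r) :=
  Classical.epsilon (IsResidue r ω)

end ResidueMap

end Henselian

/-! ### Galois covers of the projective line -/

section Covers

open scoped Pointwise

variable (k K Ω : Type*) [Field k] [CharZero k] [Field K] [Algebra k K] [IsSepClosure k K] [Field Ω]
  [Algebra (RatFunc k) Ω] [IsAlgClosure (RatFunc k) Ω] [Algebra K Ω] [Algebra k Ω]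
  [IsScalarTower k K Ω] [IsScalarTower k (RatFunc k) Ω]

/-- The function field `K(z)` of the projective line over `K`, as a subfield of the algebraic
closure `Ω` of `k(z)`. -/
abbrev geomField : IntermediateField (RatFunc k) Ω :=
  IntermediateField.adjoin (RatFunc k) (Set.range (algebraMap K Ω))

/-- The projection `Gal(Ω/k(z)) → Γ_k = Gal(K/k)`. -/
def toAbsGal : Gal(Ω/RatFunc k) →* Gal(K/k) :=
  (AlgEquiv.restrictNormalHom K).comp (AlgEquiv.restrictScalarsHom k)

theorem algebraMap_toAbsGal (g : Gal(Ω/RatFunc k)) (x : K) :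
    algebraMap K Ω (toAbsGal k K Ω g x) = g (algebraMap K Ω x) :=
  AlgEquiv.restrictNormal_commutes _ _ _

theorem ker_toAbsGal : (toAbsGal k K Ω).ker = (geomField k K Ω).fixingSubgroup := by
  ext g
  rw [MonoidHom.mem_ker]
  constructor
  · intro h
    have h1 : geomField k K Ω ≤ IntermediateField.fixedField (Subgroup.zpowers g) := by
      rw [IntermediateField.adjoin_le_iff]
      rintro _ ⟨x, rfl⟩ ⟨_, n, rfl⟩
      change (g ^ n) _ = _
      rw [← algebraMap_toAbsGal, map_zpow, h, one_zpow]
      rfl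
    exact (IntermediateField.le_iff_le _ _).1 h1 (Subgroup.mem_zpowers g)
  · intro h
    ext x
    apply (algebraMap K Ω).injective
    rw [algebraMap_toAbsGal]
    exact (IntermediateField.mem_fixingSubgroup_iff _ _).1 h _
      (IntermediateField.subset_adjoin _ _ ⟨x, rfl⟩)

/-- A `G`-cover `f : Y → ℙ¹` over `K`: a finite Galois cover of smooth projective (connected) curves
with Galois group `G`, given by the function field of `Y`, a finite Galois extension of `K(z)`
(embedded into `Ω`), and by an identification of its Galois group with `G`. -/
structure GCover (G : Type*) [Group G] where
  /-- The function field of `Y`. -/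
  functionField : IntermediateField (geomField k K Ω) Ω
  finiteDimensional : FiniteDimensional (geomField k K Ω) functionField
  isGalois : IsGalois (geomField k K Ω) functionField
  /-- The identification of the Galois group with `G`. -/
  galEquiv : Gal(functionField/geomField k K Ω) ≃* G

theorem isGalois_bigField : IsGalois (RatFunc k) Ω := by
  have : CharZero (RatFunc k) :=
    charZero_of_injective_algebraMap (algebraMap k (RatFunc k)).injective
  have : Algebra.IsAlgebraic (RatFunc k) Ω := IsAlgClosure.isAlgebraic
  have : Normal (RatFunc k) Ω := IsAlgClosure.normal _ _
  exact ⟨⟩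

namespace GCover

variable {k K Ω} {G : Type*} [Group G] (f : GCover k K Ω G)

/-- The branch locus `S` of the cover. The points of `ℙ¹` over `K` are the valuation rings of `K(z)`
that contain `K`; such a point is a branch point if some point of `Y` above it has nontrivial inertia
group. (The valuation ring `K(z)` itself, the generic point, is never a branch point.) -/
def branchLocus : Set (ValuationSubring (geomField k K Ω)) :=
  {V | (∀ x : geomField k K Ω, (x : Ω) ∈ Set.range (algebraMap K Ω) → x ∈ V) ∧
    ∃ W : ValuationSubring f.functionField,
      W.comap (algebraMap (geomField k K Ω) f.functionField) = V ∧
      W.inertiaSubgroup (geomField k K Ω) ≠ ⊥}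

/-- The closed subset `S_k` of the projective line over `k`, the image of the branch locus. -/
def branchLocusBase : Set (ValuationSubring (RatFunc k)) :=
  (fun V => V.comap (algebraMap (RatFunc k) (geomField k K Ω))) '' f.branchLocus

/-- The branch locus `S` is `Γ_k`-invariant, i.e. it is the full inverse image of `S_k`. -/
def HasInvariantBranchLocus : Prop :=
  f.branchLocus =
    (fun V => V.comap (algebraMap (RatFunc k) (geomField k K Ω))) ⁻¹' f.branchLocusBase

/-- The union of the inertia subgroups in `Gal(Ω/k(z))` at all points above
`U_k = ℙ¹_k - S_k`. -/
def inertiaUnion : Set Gal(Ω/RatFunc k) :=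
  {τ | ∃ W : ValuationSubring Ω, (∀ a : k, algebraMap k Ω a ∈ W) ∧
    W.comap (algebraMap (RatFunc k) Ω) ∉ f.branchLocusBase ∧
    τ ∈ (W.inertiaSubgroup (RatFunc k)).map (Subgroup.subtype _)}

/-- The closed normal subgroup of `Gal(Ω/k(z))` whose fixed field is the maximal extension of `k(z)`
inside `Ω` that is unramified over `U_k`. -/
def unramifiedKernel : Subgroup Gal(Ω/RatFunc k) :=
  (Subgroup.normalClosure f.inertiaUnion).topologicalClosure

instance : f.unramifiedKernel.Normal := Subgroup.is_normal_topologicalClosure _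

/-- The fundamental group `π₁(U_k)`: the Galois group of the maximal extension of `k(z)` that is
unramified over `U_k`. -/
abbrev ArithPi : Type _ := Gal(Ω/RatFunc k) ⧸ f.unramifiedKernel

/-- The function field of `Y`, as an extension of `k(z)`. -/
abbrev functionField' : IntermediateField (RatFunc k) Ω :=
  f.functionField.restrictScalars (RatFunc k)

theorem mem_inertia_iff {E L : Type*} [Field E] [Field L] [Algebra E L] (W : ValuationSubring L)
    (τ : Gal(L/E)) : τ ∈ (W.inertiaSubgroup E).map (Subgroup.subtype _) ↔
      (∀ x, τ x ∈ W ↔ x ∈ W) ∧ ∀ x ∈ W, ∀ y ∈ W, y * (τ x - x) ≠ 1 := by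
  have hstab : τ ∈ W.decompositionSubgroup E ↔ ∀ x, τ x ∈ W ↔ x ∈ W := by
    rw [MulAction.mem_stabilizer_iff]
    constructor
    · intro h x
      have h1 : τ • x ∈ τ • W ↔ x ∈ W := ValuationSubring.smul_mem_pointwise_smul_iff
      rwa [h] at h1
    · intro h
      ext x
      rw [ValuationSubring.mem_pointwise_smul_iff_inv_smul_mem, ← h]
      change τ (τ.symm x) ∈ W ↔ _
      rw [AlgEquiv.apply_symm_apply]
  have hin (g : W.decompositionSubgroup E) : g ∈ W.inertiaSubgroup E ↔
      ∀ x ∈ W, ∀ y ∈ W, y * ((g : Gal(L/E)) x - x) ≠ 1 := by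
    rw [ValuationSubring.inertiaSubgroup, MonoidHom.mem_ker]
    have h1 : MulSemiringAction.toRingAut (W.decompositionSubgroup E)
        (IsLocalRing.ResidueField W) g = 1 ↔
        ∀ x : W, IsLocalRing.residue W (g • x) = IsLocalRing.residue W x := by
      constructor
      · intro h x
        exact congrArg (fun e : RingAut (IsLocalRing.ResidueField W) =>
          e (IsLocalRing.residue W x)) h
      · intro h
        ext x
        obtain ⟨x, rfl⟩ := IsLocalRing.residue_surjective x
        exact h x
    rw [h1]
    have h2 (x : W) : IsLocalRing.residue W (g • x) = IsLocalRing.residue W x ↔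
        ∀ y ∈ W, y * ((g : Gal(L/E)) x - x) ≠ 1 := by
      rw [← sub_eq_zero, ← map_sub, IsLocalRing.residue_eq_zero_iff, IsLocalRing.mem_maximalIdeal,
        mem_nonunits_iff, isUnit_iff_exists_inv']
      push Not
      constructor
      · intro h y hy h'
        exact h ⟨y, hy⟩ (Subtype.ext h')
      · intro h y h'
        exact h y.1 y.2 (congrArg Subtype.val h')
    exact ⟨fun h x hx => (h2 ⟨x, hx⟩).1 (h _), fun h x => (h2 x).2 (h x.1 x.2)⟩
  constructor
  · rintro ⟨g, hg, rfl⟩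
    exact ⟨hstab.1 g.2, (hin g).1 hg⟩
  · rintro ⟨h1, h2⟩
    exact ⟨⟨τ, hstab.2 h1⟩, (hin _).2 h2, rfl⟩

theorem inertiaUnion_subset {τ : Gal(Ω/RatFunc k)} (hτ : τ ∈ f.inertiaUnion) :
    τ ∈ f.functionField'.fixingSubgroup := by
  obtain ⟨W, hk, hS, hW⟩ := hτ
  rw [mem_inertia_iff] at hW
  obtain ⟨hW1, hW2⟩ := hW
  have : Algebra.IsSeparable k K := IsSepClosure.separable
  have hK (x : K) : algebraMap K Ω x ∈ W := by
    have h1 : IsIntegral k (algebraMap K Ω x) :=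
      (Algebra.IsIntegral.isIntegral (R := k) x).algebraMap
    let i : k →+* W := (algebraMap k Ω).codRestrict W.toSubring hk
    have h2 : IsIntegral W (algebraMap K Ω x) :=
      h1.map_of_comp_eq i (RingHom.id Ω) rfl
    obtain ⟨y, hy⟩ := IsIntegrallyClosed.isIntegral_iff.1 h2
    rw [← hy]
    exact y.2
  have h1 : toAbsGal k K Ω τ = 1 := by
    ext x
    by_contra hne
    have hne' : toAbsGal k K Ω τ x - x ≠ 0 := sub_ne_zero.2 hne
    refine hW2 _ (hK x) _ (hK (toAbsGal k K Ω τ x - x)⁻¹) ?_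
    rw [← algebraMap_toAbsGal, ← map_sub, ← map_mul, inv_mul_cancel₀ hne', map_one]
  have hgeom : τ ∈ (geomField k K Ω).fixingSubgroup := by
    rw [← ker_toAbsGal]
    exact h1
  have := f.isGalois
  let τ' : Gal(Ω/geomField k K Ω) :=
    IntermediateField.fixingSubgroupEquiv (geomField k K Ω) ⟨τ, hgeom⟩
  let σ : Gal(f.functionField/geomField k K Ω) := AlgEquiv.restrictNormalHom f.functionField τ'
  have hσ (x : f.functionField) : (σ x : Ω) = τ x :=
    AlgEquiv.restrictNormal_commutes τ' f.functionField x
  let WF : ValuationSubring f.functionField := W.comap (algebraMap f.functionField Ω)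
  have hWF : WF.inertiaSubgroup (geomField k K Ω) = ⊥ := by
    by_contra hne
    refine hS ⟨W.comap (algebraMap (geomField k K Ω) Ω), ⟨?_, WF, rfl, hne⟩, rfl⟩
    rintro x ⟨y, hy⟩
    change (x : Ω) ∈ W
    rw [← hy]
    exact hK y
  have hσ1 : σ ∈ (WF.inertiaSubgroup (geomField k K Ω)).map (Subgroup.subtype _) := by
    rw [mem_inertia_iff]
    constructor
    · intro x
      change (σ x : Ω) ∈ W ↔ (x : Ω) ∈ W
      rw [hσ, hW1]
    · intro x hx y hy h
      refine hW2 x hx y hy ?_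
      have h2 := congrArg (algebraMap f.functionField Ω) h
      rw [map_mul, map_sub, map_one] at h2
      rw [← hσ]
      exact h2
  rw [hWF, Subgroup.map_bot, Subgroup.mem_bot] at hσ1
  rw [IntermediateField.mem_fixingSubgroup_iff]
  intro x hx
  have h3 := hσ ⟨x, hx⟩
  rw [hσ1] at h3
  exact h3.symm

theorem conj_inertiaUnion {τ : Gal(Ω/RatFunc k)} (hτ : τ ∈ f.inertiaUnion)
    (g : Gal(Ω/RatFunc k)) : MulAut.conj g τ ∈ f.inertiaUnion := by
  obtain ⟨W, hk, hS, hW⟩ := hτ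
  rw [mem_inertia_iff] at hW
  obtain ⟨hW1, hW2⟩ := hW
  have hc (x : Ω) : g.symm (MulAut.conj g τ x) = τ (g.symm x) := by
    change g.symm (g (τ (g.symm x))) = _
    rw [AlgEquiv.symm_apply_apply]
  refine ⟨W.comap (g.symm : Ω →+* Ω), fun a => ?_, ?_, ?_⟩
  · change g.symm (algebraMap k Ω a) ∈ W
    rw [IsScalarTower.algebraMap_apply k (RatFunc k) Ω, AlgEquiv.commutes,
      ← IsScalarTower.algebraMap_apply k (RatFunc k) Ω]
    exact hk a
  · suffices h : (W.comap (g.symm : Ω →+* Ω)).comap (algebraMap (RatFunc k) Ω) =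
        W.comap (algebraMap (RatFunc k) Ω) by rwa [h]
    ext x
    change g.symm (algebraMap (RatFunc k) Ω x) ∈ W ↔ algebraMap (RatFunc k) Ω x ∈ W
    rw [AlgEquiv.commutes]
  · rw [mem_inertia_iff]
    constructor
    · intro x
      change g.symm (MulAut.conj g τ x) ∈ W ↔ g.symm x ∈ W
      rw [hc, hW1]
    · intro x hx y hy h
      refine hW2 (g.symm x) hx (g.symm y) hy ?_
      rw [← hc, ← map_sub, ← map_mul, h, map_one]

theorem unramifiedKernel_le : f.unramifiedKernel ≤ f.functionField'.fixingSubgroup := by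
  have : IsGalois (RatFunc k) Ω := isGalois_bigField k Ω
  refine Subgroup.topologicalClosure_minimal _ ?_ (InfiniteGalois.fixingSubgroup_isClosed _)
  refine (Subgroup.closure_le _).2 fun τ hτ => ?_
  obtain ⟨σ, hσ, hστ⟩ := Group.mem_conjugatesOfSet_iff.1 hτ
  obtain ⟨g, rfl⟩ := isConj_iff.1 hστ
  exact f.inertiaUnion_subset (f.conj_inertiaUnion hσ g)

theorem functionField'_fixing_le :
    f.functionField'.fixingSubgroup ≤ (geomField k K Ω).fixingSubgroup := by
  refine IntermediateField.fixingSubgroup_antitone fun x hx => ?_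
  exact f.functionField.algebraMap_mem ⟨x, hx⟩

/-- The projection `π₁(U_k) → Γ_k`. -/
def proj : f.ArithPi →* Gal(K/k) :=
  QuotientGroup.lift _ (toAbsGal k K Ω) (by
    rw [ker_toAbsGal]
    exact f.unramifiedKernel_le.trans f.functionField'_fixing_le)

/-- The fundamental group `π₁(U)` of `U = ℙ¹_K - S`, the kernel of `π₁(U_k) → Γ_k`. -/
abbrev geomPi : Subgroup f.ArithPi := f.proj.ker

/-- The homomorphism `Gal(Ω/K(z)) → G` given by restriction to the function field of `Y`. -/
def galHom : (geomField k K Ω).fixingSubgroup →* G :=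
  haveI := f.isGalois
  f.galEquiv.toMonoidHom.comp ((AlgEquiv.restrictNormalHom f.functionField).comp
    (IntermediateField.fixingSubgroupEquiv (geomField k K Ω)).toMonoidHom)

/-- The projection `Gal(Ω/K(z)) → π₁(U)`. -/
def geomQuot : (geomField k K Ω).fixingSubgroup →* f.geomPi :=
  ((QuotientGroup.mk' f.unramifiedKernel).comp (Subgroup.subtype _)).codRestrict _ fun g => by
    rw [MonoidHom.mem_ker]
    change toAbsGal k K Ω g = 1
    rw [← MonoidHom.mem_ker, ker_toAbsGal]
    exact g.2

theorem geomQuot_surjective : Function.Surjective f.geomQuot := by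
  rintro ⟨γ, hγ⟩
  obtain ⟨g, rfl⟩ := QuotientGroup.mk_surjective γ
  have hg : g ∈ (geomField k K Ω).fixingSubgroup := by
    rw [← ker_toAbsGal]
    exact hγ
  exact ⟨⟨g, hg⟩, rfl⟩

theorem galHom_eq_one_iff (g : (geomField k K Ω).fixingSubgroup) :
    f.galHom g = 1 ↔ (g : Gal(Ω/RatFunc k)) ∈ f.functionField'.fixingSubgroup := by
  have := f.isGalois
  have h (x : f.functionField) : (AlgEquiv.restrictNormalHom f.functionField
      (IntermediateField.fixingSubgroupEquiv (geomField k K Ω) g) x : Ω) =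
      (g : Gal(Ω/RatFunc k)) x :=
    AlgEquiv.restrictNormal_commutes (IntermediateField.fixingSubgroupEquiv _ g) f.functionField x
  change f.galEquiv (AlgEquiv.restrictNormalHom f.functionField
      (IntermediateField.fixingSubgroupEquiv (geomField k K Ω) g)) = 1 ↔ _
  rw [map_eq_one_iff _ f.galEquiv.injective, IntermediateField.mem_fixingSubgroup_iff]
  constructor
  · intro h1 x hx
    rw [← h ⟨x, hx⟩, h1]
    rfl
  · intro h1
    ext x
    rw [h, h1 _ x.2]
    rfl

theorem galHom_surjective : Function.Surjective f.galHom := by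
  have := f.isGalois
  have : IsAlgClosed Ω := IsAlgClosure.isAlgClosed (RatFunc k)
  have : Algebra.IsAlgebraic (RatFunc k) Ω := IsAlgClosure.isAlgebraic
  have : Algebra.IsAlgebraic (geomField k K Ω) Ω := Algebra.IsAlgebraic.tower_top (K := RatFunc k) _
  have : IsAlgClosure (geomField k K Ω) Ω := ⟨inferInstance, inferInstance⟩
  have : Normal (geomField k K Ω) Ω := IsAlgClosure.normal _ _
  exact f.galEquiv.surjective.comp ((AlgEquiv.restrictNormalHom_surjective Ω).comp
    (IntermediateField.fixingSubgroupEquiv _).surjective)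

/-- The surjective homomorphism `Φ : π₁(U) → G` corresponding to the `G`-cover. -/
def Phi : f.geomPi →* G :=
  MonoidHom.liftOfSurjective f.geomQuot f.geomQuot_surjective ⟨f.galHom, by
    intro g hg
    rw [MonoidHom.mem_ker, galHom_eq_one_iff]
    refine f.unramifiedKernel_le ?_
    rw [MonoidHom.mem_ker] at hg
    exact (QuotientGroup.eq_one_iff (g : Gal(Ω/RatFunc k))).1 (congrArg Subtype.val hg)⟩

theorem Phi_geomQuot (g : (geomField k K Ω).fixingSubgroup) : f.Phi (f.geomQuot g) = f.galHom g :=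
  MonoidHom.liftOfRightInverse_comp_apply _ _ _ _ _

theorem Phi_surjective : Function.Surjective f.Phi := fun x => by
  obtain ⟨g, rfl⟩ := f.galHom_surjective x
  exact ⟨_, f.Phi_geomQuot g⟩

/-- `h` is an admissible choice of `h_σ`: one has `Φ(ᵟγ) = h Φ(γ) h⁻¹` for all `γ ∈ π₁(U)`, where
`ᵟγ = s(σ) γ s(σ)⁻¹`. -/
def IsConjugator (s : Gal(K/k) →* f.ArithPi) (σ : Gal(K/k)) (h : G) : Prop :=
  ∀ γ : f.geomPi, f.Phi (MulAut.conjNormal (s σ) γ) = h * f.Phi γ * h⁻¹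

/-- `k` is a field of moduli of the `G`-cover (`s` is a section of `π₁(U_k) → Γ_k`). -/
def IsFieldOfModuli (s : Gal(K/k) →* f.ArithPi) : Prop := ∀ σ, ∃ h : G, f.IsConjugator s σ h

variable {f}

theorem IsConjugator.mul {s : Gal(K/k) →* f.ArithPi} {σ τ : Gal(K/k)} {g h : G}
    (hg : f.IsConjugator s σ g) (hh : f.IsConjugator s τ h) : f.IsConjugator s (σ * τ) (g * h) := by
  intro γ
  rw [map_mul, map_mul, MulAut.mul_apply, hg, hh]
  group

theorem IsConjugator.mk_eq {s : Gal(K/k) →* f.ArithPi} {σ : Gal(K/k)} {g h : G}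
    (hg : f.IsConjugator s σ g) (hh : f.IsConjugator s σ h) :
    (g : G ⧸ Subgroup.center G) = h := by
  rw [QuotientGroup.eq, Subgroup.mem_center_iff]
  intro x
  obtain ⟨γ, rfl⟩ := f.Phi_surjective x
  have h1 := (hg γ).symm.trans (hh γ)
  calc _ = g⁻¹ * (g * f.Phi γ * g⁻¹) * h := by group
    _ = _ := by rw [h1]; group

/-- The homomorphism `φ̄ : Γ_k → G/C`, `σ ↦ h_σ C`, attached to a `G`-cover with field of moduli
`k` and to a section `s` of `π₁(U_k) → Γ_k`. -/
def phibar {s : Gal(K/k) →* f.ArithPi} (hf : f.IsFieldOfModuli s) :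
    Gal(K/k) →* G ⧸ Subgroup.center G :=
  MonoidHom.mk' (fun σ => ((hf σ).choose : G)) fun σ τ =>
    (hf (σ * τ)).choose_spec.mk_eq ((hf σ).choose_spec.mul (hf τ).choose_spec)

theorem phibar_eq {s : Gal(K/k) →* f.ArithPi} (hf : f.IsFieldOfModuli s) {σ : Gal(K/k)} {h : G}
    (hh : f.IsConjugator s σ h) : phibar hf σ = h :=
  (hf σ).choose_spec.mk_eq hh

theorem exists_open_normal (f : GCover k K Ω G) : ∃ V : Subgroup Gal(Ω/RatFunc k), V.Normal ∧
    IsOpen (V : Set Gal(Ω/RatFunc k)) ∧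
    V ⊓ (geomField k K Ω).fixingSubgroup ≤ f.functionField'.fixingSubgroup := by
  have := isGalois_bigField k Ω
  have := f.finiteDimensional
  obtain ⟨S, hS⟩ := Module.Finite.fg_top (R := geomField k K Ω) (M := f.functionField)
  let M : FiniteGaloisIntermediateField (RatFunc k) Ω :=
    FiniteGaloisIntermediateField.adjoin (RatFunc k) (Subtype.val '' (S : Set f.functionField))
  have : IsGalois (RatFunc k) M.toIntermediateField := M.isGalois
  have : FiniteDimensional (RatFunc k) M.toIntermediateField := M.finiteDimensional
  refine ⟨M.toIntermediateField.fixingSubgroup, ?_,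
    IntermediateField.fixingSubgroup_isOpen _, ?_⟩
  · rw [← IntermediateField.restrictNormalHom_ker]
    infer_instance
  rintro g ⟨hg1, hg2⟩
  replace hg1 := (IntermediateField.mem_fixingSubgroup_iff _ _).1 hg1
  replace hg2 := (IntermediateField.mem_fixingSubgroup_iff _ _).1 hg2
  rw [IntermediateField.mem_fixingSubgroup_iff]
  intro x hx
  have hx' : (⟨x, hx⟩ : f.functionField) ∈ Submodule.span (geomField k K Ω)
      (S : Set f.functionField) := hS ▸ Submodule.mem_top
  refine Submodule.span_induction (p := fun (y : f.functionField) _ => g (y : Ω) = y)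
    ?_ ?_ ?_ ?_ hx'
  · intro y hy
    exact hg1 _ (FiniteGaloisIntermediateField.subset_adjoin _ _ ⟨y, hy, rfl⟩)
  · exact map_zero g
  · intro y w _ _ hy hw
    change g ((y : Ω) + w) = y + w
    rw [map_add, hy, hw]
  · intro a y _ hy
    change g ((a : Ω) * y) = a * y
    rw [map_mul, hy, hg2 _ a.2]

theorem phibar_isLocallyConstant {s : Gal(K/k) →* f.ArithPi} (hs : Continuous s)
    (hf : f.IsFieldOfModuli s) : IsLocallyConstant (phibar hf) := by
  obtain ⟨V, hVn, hVo, hV⟩ := f.exists_open_normal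
  have key : ∀ σ, s σ ∈ V.map (QuotientGroup.mk' f.unramifiedKernel) → phibar hf σ = 1 := by
    rintro σ ⟨v, hv, hvσ⟩
    refine phibar_eq hf (h := 1) fun γ => ?_
    obtain ⟨g, rfl⟩ := f.geomQuot_surjective γ
    have hn : (geomField k K Ω).fixingSubgroup.Normal := by
      rw [← ker_toAbsGal]
      infer_instance
    have h1 : MulAut.conjNormal (s σ) (f.geomQuot g) = f.geomQuot (MulAut.conjNormal v g) := by
      apply Subtype.ext
      rw [← hvσ]
      rfl
    rw [h1, one_mul, inv_one, mul_one, Phi_geomQuot, Phi_geomQuot, ← div_eq_one, ← map_div,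
      galHom_eq_one_iff]
    refine hV ⟨?_, SetLike.coe_mem _⟩
    have h2 : ((MulAut.conjNormal v g / g : (geomField k K Ω).fixingSubgroup) :
        Gal(Ω/RatFunc k)) = v * MulAut.conj (g : Gal(Ω/RatFunc k)) (v⁻¹) := by
      simp [div_eq_mul_inv, mul_assoc]
    rw [h2]
    exact V.mul_mem hv (hVn.conj_mem _ (V.inv_mem hv) _)
  have hopen : IsOpen ((V.map (QuotientGroup.mk' f.unramifiedKernel) : Subgroup f.ArithPi) :
      Set f.ArithPi) := QuotientGroup.isOpenMap_coe _ hVo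
  rw [IsLocallyConstant.iff_eventually_eq]
  intro σ
  have h3 : {τ | s (σ⁻¹ * τ) ∈ V.map (QuotientGroup.mk' f.unramifiedKernel)} ∈ nhds σ := by
    refine (hopen.preimage (hs.comp (continuous_const.mul continuous_id))).mem_nhds ?_
    change s (σ⁻¹ * σ) ∈ V.map (QuotientGroup.mk' f.unramifiedKernel)
    rw [inv_mul_cancel, map_one]
    exact one_mem _
  filter_upwards [h3] with τ hτ
  have h4 := key _ hτ
  rw [map_mul, map_inv, inv_mul_eq_one] at h4
  exact h4.symm

/-- The f.o.d.-obstruction `ω ∈ H²(k, C)` of a `G`-cover with field of moduli `k`: the class of the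
cocycle `(σ, τ) ↦ h_σ h_τ h_{στ}⁻¹`. -/
def obstruction {s : Gal(K/k) →* f.ArithPi} (hs : Continuous s) (hf : f.IsFieldOfModuli s) :
    H2 (Gal(K/k)) (Subgroup.center G) :=
  liftingObstruction (phibar hf) (phibar_isLocallyConstant hs hf)

end GCover

end Covers

end TameCover

end

/-! An element `x` of `G/C` whose order is prime to `|C|` has exactly one lift to `G` of the same
order: two lifts differ by a central element, and a central element killed by an exponent prime to
`|C|` is trivial. Being unique, this lift is compatible with conjugation by `G` and with powers of
`x`.

The obstruction class may be computed with any set-theoretic section `t` of `G → G/C`; take for `t`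
a section that picks this distinguished lift whenever the order allows it. Tameness lets `φ̄`
descend to the tame quotient, where inertia lands in the cyclic group generated by `φ̄(q₀)`. There
`t` is multiplicative, so the cocycle `c` is trivial on inertia. Moreover `c(q, σ)` and `c(σ,
σ⁻¹qσ)` both end in the inverse of `t(φ̄(qσ))`, and what precedes it agrees because `t` commutes
with conjugation. Hence the residue cocycle is already `1`, with no coboundary to correct
(`isEdge_liftingObstruction_one`, `isResidue_liftingObstruction_one`).

Since `residueMap` is defined by choice from the relation `IsResidue`, that relation must also be
shown single-valued. The edge map does not depend on the representing cocycle (`IsEdge.unique`), and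
inflation from the tame quotient is injective on `H²` (`H2.pullback_mk_injective`) because wild
inertia has no nontrivial continuous homomorphism to a finite group of order invertible in the
residue field (`wildInertia_hom_eq_one`). Surjectivity of inflation is not needed, as the class on
the tame quotient is given explicitly. -/

noncomputable section

namespace TameCover

/-! ### Distinguished lifts of elements of `G/C` of order prime to `|C|` -/

section CoprimeLift

variable {G : Type*} [Group G]

/-- The quotient `x⁻¹y` is central, so it commutes with `x` and is itself killed by `m`; it is also
killed by `|C|`. This uniqueness is the source of all compatibilities of the lift. -/
theorem eq_of_mk_eq_of_pow_eq_one {m : ℕ} (hm : m.Coprime (Nat.card (Subgroup.center G)))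
    {x y : G} (h : (x : G ⧸ Subgroup.center G) = y) (hx : x ^ m = 1) (hy : y ^ m = 1) : x = y := by
  rw [QuotientGroup.eq] at h
  have hcomm : Commute x (x⁻¹ * y) := Subgroup.mem_center_iff.1 h x
  have h1 : (x⁻¹ * y) ^ m = 1 := by
    have h2 := hcomm.mul_pow m
    rwa [mul_inv_cancel_left, hx, hy, one_mul, eq_comm] at h2
  have h3 : (⟨x⁻¹ * y, h⟩ : Subgroup.center G) ^ m = 1 := Subtype.ext h1
  have h4 : orderOf (⟨x⁻¹ * y, h⟩ : Subgroup.center G) = 1 :=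
    Nat.eq_one_of_dvd_coprimes hm (orderOf_dvd_of_pow_eq_one h3) (orderOf_dvd_natCard _)
  have h5 := congrArg Subtype.val (orderOf_eq_one_iff.1 h4)
  exact inv_mul_eq_one.1 h5

theorem exists_lift_pow_orderOf_eq_one (x : G ⧸ Subgroup.center G) : ∃ y : G,
    (y : G ⧸ Subgroup.center G) = x ∧
      ((orderOf x).Coprime (Nat.card (Subgroup.center G)) → y ^ orderOf x = 1) := by
  obtain ⟨y, rfl⟩ := QuotientGroup.mk_surjective x
  by_cases h : (orderOf (y : G ⧸ Subgroup.center G)).Coprime (Nat.card (Subgroup.center G))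
  -- Here `a` inverts `|C|` modulo the order of `x`, so raising `y` to the power `a|C|` leaves its
  -- image unchanged while removing the central part of its order.
  · obtain ⟨a, ha⟩ := exists_pow_eq_self_of_coprime h.symm
    refine ⟨(y ^ Nat.card (Subgroup.center G)) ^ a, ha, fun _ => ?_⟩
    have h1 : y ^ orderOf (y : G ⧸ Subgroup.center G) ∈ Subgroup.center G := by
      rw [← QuotientGroup.eq_one_iff, QuotientGroup.mk_pow, pow_orderOf_eq_one]
    have h2 : (⟨_, h1⟩ : Subgroup.center G) ^ Nat.card (Subgroup.center G) = 1 :=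
      pow_card_eq_one'
    have h3 : (y ^ orderOf (y : G ⧸ Subgroup.center G)) ^ Nat.card (Subgroup.center G) = 1 :=
      congrArg Subtype.val h2
    rw [← pow_mul, ← pow_mul, mul_comm a, ← mul_assoc, mul_comm (Nat.card _), pow_mul, pow_mul,
      h3, one_pow]
  -- Without coprimality any lift will do; this makes the lift a section on all of `G/C`.
  · exact ⟨y, rfl, fun h' => absurd h' h⟩

/-- A lift of an element of `G/C` to `G`. If the order of the element is prime to the order of `C`,
then its lift has the same order. -/
def coprimeLift (x : G ⧸ Subgroup.center G) : G := (exists_lift_pow_orderOf_eq_one x).choose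

@[simp]
theorem mk_coprimeLift (x : G ⧸ Subgroup.center G) :
    ((coprimeLift x : G) : G ⧸ Subgroup.center G) = x :=
  (exists_lift_pow_orderOf_eq_one x).choose_spec.1

theorem coprimeLift_pow_orderOf {x : G ⧸ Subgroup.center G}
    (hx : (orderOf x).Coprime (Nat.card (Subgroup.center G))) : coprimeLift x ^ orderOf x = 1 :=
  (exists_lift_pow_orderOf_eq_one x).choose_spec.2 hx

/-- The order of `x` divides `m`, so `m` kills both lifts and uniqueness applies. Allowing a
multiple `m` of the order covers powers of an element, whose order may be smaller than that of the
element. -/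
theorem coprimeLift_eq {x : G ⧸ Subgroup.center G} {y : G} {m : ℕ}
    (hm : m.Coprime (Nat.card (Subgroup.center G))) (hxy : (y : G ⧸ Subgroup.center G) = x)
    (hy : y ^ m = 1) : coprimeLift x = y := by
  have hd : orderOf x ∣ m := by
    rw [← hxy]
    exact orderOf_dvd_of_pow_eq_one (by rw [← QuotientGroup.mk_pow, hy, QuotientGroup.mk_one])
  refine eq_of_mk_eq_of_pow_eq_one hm (by rw [mk_coprimeLift, hxy]) ?_ hy
  obtain ⟨e, rfl⟩ := hd
  rw [pow_mul, coprimeLift_pow_orderOf (hm.coprime_dvd_left ⟨e, rfl⟩), one_pow]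

theorem coprimeLift_conj {x : G ⧸ Subgroup.center G}
    (hx : (orderOf x).Coprime (Nat.card (Subgroup.center G))) (g : G) :
    coprimeLift ((g : G ⧸ Subgroup.center G) * x * (g : G ⧸ Subgroup.center G)⁻¹) = g * coprimeLift x * g⁻¹ :=
  coprimeLift_eq hx (by simp) (by rw [conj_pow, coprimeLift_pow_orderOf hx, mul_one, mul_inv_cancel])

theorem coprimeLift_zpow {x : G ⧸ Subgroup.center G}
    (hx : (orderOf x).Coprime (Nat.card (Subgroup.center G))) (i : ℤ) :
    coprimeLift (x ^ i) = coprimeLift x ^ i :=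
  coprimeLift_eq hx (by simp) (by
    rw [← zpow_natCast, zpow_comm, zpow_natCast, coprimeLift_pow_orderOf hx, one_zpow])

end CoprimeLift

/-! ### The lifting obstruction for an arbitrary section, and its image under the edge map -/

section LiftingCocycle

variable {Γ : Type*} [Group Γ] [TopologicalSpace Γ] [IsTopologicalGroup Γ] {G : Type*} [Group G]

/-- A set-theoretic section of `G → G/C` differs from the chosen one by an element of `C`. -/
def sectionDiff (t : G ⧸ Subgroup.center G → G)
    (ht : ∀ x, (t x : G ⧸ Subgroup.center G) = x) (x : G ⧸ Subgroup.center G) : Subgroup.center G :=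
  ⟨t x * x.out⁻¹, by rw [← QuotientGroup.eq_one_iff]; simp [ht]⟩

/-- The lifting obstruction can be computed with an arbitrary set-theoretic section `t` of
`G → G/C`. -/
theorem exists_liftingObstruction_eq (φ : Γ →* G ⧸ Subgroup.center G) (hφ : IsLocallyConstant φ)
    (t : G ⧸ Subgroup.center G → G) (ht : ∀ x, (t x : G ⧸ Subgroup.center G) = x) :
    ∃ c : Z2 Γ (Subgroup.center G), QuotientGroup.mk c = liftingObstruction φ hφ ∧
      ∀ σ τ, (c.1 (σ, τ) : G) = t (φ σ) * t (φ τ) * (t (φ (σ * τ)))⁻¹ := by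
  let u : Γ → Subgroup.center G := fun σ => sectionDiff t ht (φ σ)
  have hu : IsLocallyConstant u := hφ.comp (sectionDiff t ht)
  let b : Z2 Γ (Subgroup.center G) := ⟨fun p => u p.1 * u p.2 / u (p.1 * p.2), by
    refine ⟨((hu.comp_continuous continuous_fst).mul (hu.comp_continuous continuous_snd)).div
      (hu.comp_continuous continuous_mul), fun σ τ υ => ?_⟩
    simp only [mul_assoc σ, div_eq_mul_inv]
    -- With the values of `u` on products made into atoms, each side of the cocycle identity is the
    -- same expression times a cancelling pair, `w2⁻¹ * w2` or `w1⁻¹ * w1`.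
    generalize u (σ * (τ * υ)) = w
    generalize u (σ * τ) = w1
    generalize u (τ * υ) = w2
    rw [show u τ * u υ * w2⁻¹ * (u σ * w2 * w⁻¹) = u τ * u υ * u σ * w⁻¹ * (w2⁻¹ * w2) by
        simp only [mul_assoc, mul_left_comm, mul_comm],
      show w1 * u υ * w⁻¹ * (u σ * u τ * w1⁻¹) = u τ * u υ * u σ * w⁻¹ * (w1⁻¹ * w1) by
        simp only [mul_assoc, mul_left_comm, mul_comm], inv_mul_cancel, inv_mul_cancel]⟩
  refine ⟨liftingCocycle φ hφ * b, ?_, fun σ τ => ?_⟩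
  · rw [liftingObstruction, eq_comm, QuotientGroup.eq, inv_mul_cancel_left]
    exact ⟨u, hu, fun _ _ => rfl⟩
  · have hc (x : Subgroup.center G) (y : G) : y * x = x * y := Subgroup.mem_center_iff.1 x.2 y
    have e (σ : Γ) : t (φ σ) = u σ * (φ σ).out := by simp [u, sectionDiff]
    change (φ σ).out * (φ τ).out * (φ (σ * τ)).out⁻¹ *
      ((u σ * u τ / u (σ * τ) : Subgroup.center G) : G) = _
    -- Each value of `t` is a central value of `u` times the chosen representative, and the central
    -- factors are collected in front.
    have h1 : (u σ : G) * (φ σ).out * (u τ * (φ τ).out) = u σ * u τ * ((φ σ).out * (φ τ).out) := by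
      rw [mul_assoc, ← mul_assoc (φ σ).out, hc (u τ)]
      simp only [mul_assoc]
    have h2 : ((φ (σ * τ)).out)⁻¹ * (u (σ * τ) : G)⁻¹ =
        (u (σ * τ) : G)⁻¹ * ((φ (σ * τ)).out)⁻¹ := by
      rw [← mul_inv_rev, ← mul_inv_rev, hc]
    rw [hc, e, e, e, h1, mul_inv_rev, h2, Subgroup.coe_div, Subgroup.coe_mul, div_eq_mul_inv]
    have h3 : (φ σ).out * (φ τ).out * (u (σ * τ) : G)⁻¹ =
        (u (σ * τ) : G)⁻¹ * ((φ σ).out * (φ τ).out) :=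
      hc (u (σ * τ))⁻¹ _
    rw [mul_assoc (u σ * u τ : G) (_ * _) (_ * _), ← mul_assoc (_ * _) (_)⁻¹ (_)⁻¹, h3]
    simp only [mul_assoc]

/-- The edge map kills the obstruction to lifting `φ : Γ → G/C` if `φ` maps the kernel `N` to a
cyclic group of order prime to the order of `C`. -/
theorem isEdge_liftingObstruction_one (N : Subgroup Γ) [N.Normal] {Q : Type*} [Group Q]
    [TopologicalSpace Q] (r : Q →* Γ) (φ : Γ →* G ⧸ Subgroup.center G) (hφ : IsLocallyConstant φ)
    (g : G ⧸ Subgroup.center G) (hg : (orderOf g).Coprime (Nat.card (Subgroup.center G)))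
    (hN : ∀ q ∈ N, φ q ∈ Subgroup.zpowers g) :
    IsEdge N r (liftingObstruction φ hφ) 1 := by
  obtain ⟨c, hc, hc'⟩ := exists_liftingObstruction_eq φ hφ coprimeLift mk_coprimeLift
  refine ⟨c, hc, fun m n => Subtype.ext ?_, 1, rfl, fun σ q => ?_⟩
  -- On `N` all values of `φ` are powers of `g`, where the lift is multiplicative.
  · obtain ⟨i, hi⟩ := hN m m.2
    obtain ⟨j, hj⟩ := hN n n.2
    simp only at hi hj
    rw [hc', map_mul, ← hi, ← hj, ← zpow_add, coprimeLift_zpow hg, coprimeLift_zpow hg,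
      coprimeLift_zpow hg, zpow_add, mul_inv_cancel, Subgroup.coe_one]
  · have hq : (orderOf (φ q)).Coprime (Nat.card (Subgroup.center G)) :=
      hg.coprime_dvd_left (orderOf_dvd_of_mem_zpowers (hN q q.2))
    change 1 = _
    rw [eq_comm, div_eq_one]
    apply Subtype.ext
    -- The two cocycle values thus share their last factor. Conjugating by the inverse of the lift
    -- `h` of `φ (r σ)` shows that the lift of `φ ((r σ)⁻¹ * q * r σ)` is `h⁻¹ * coprimeLift (φ q) *
    -- h`, which matches the rest.
    have h1 : r σ * ((r σ)⁻¹ * q * r σ) = q * r σ := by group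
    have h2 := coprimeLift_conj hq (coprimeLift (φ (r σ)))⁻¹
    rw [QuotientGroup.mk_inv, mk_coprimeLift, inv_inv, inv_inv, ← map_inv, ← map_mul,
      ← map_mul] at h2
    rw [hc', hc', h1, h2]
    group

end LiftingCocycle

/-! ### Single-valuedness of the edge map and injectivity of inflation -/

section EdgeMap

variable {Γ : Type*} [Group Γ] [TopologicalSpace Γ] {A : Type*} [CommGroup A]

/-- Two representatives that are trivial on `N × N` differ by the coboundary of a cochain `u` whose
restriction `η` to `N` is a homomorphism. In the quotient of the edge cocycles the values of `u` at
`r σ` and `q * r σ` cancel, and the coboundary of `η` remains. -/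
theorem IsEdge.unique [IsTopologicalGroup Γ] {N : Subgroup Γ} [N.Normal] {Q : Type*} [Group Q]
    [TopologicalSpace Q] {r : Q →* Γ} {α : H2 Γ A} {β β' : H1 ((conjAction N A).comp r)}
    (h : IsEdge N r α β) (h' : IsEdge N r α β') : β = β' := by
  obtain ⟨c, rfl, hc, z, rfl, hz⟩ := h
  obtain ⟨c', hcc', hc', z', rfl, hz'⟩ := h'
  rw [QuotientGroup.eq] at hcc'
  obtain ⟨u, hu, hu'⟩ := hcc'
  replace hu' (σ τ : Γ) : c.1 (σ, τ) = c'.1 (σ, τ) * (u σ * u τ / u (σ * τ)) := by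
    rw [← hu' σ τ]
    change _ = c'.1 (σ, τ) * ((c'.1 (σ, τ))⁻¹ * c.1 (σ, τ))
    rw [mul_inv_cancel_left]
  have hmul (m n : N) : u (m * n) = u m * u n := by
    have h1 := hu' m n
    rw [hc, hc', one_mul, eq_comm, div_eq_one] at h1
    exact h1.symm
  let η : N →* A := MonoidHom.mk' (fun q => u q) fun m n => hmul m n
  have hη : IsLocallyConstant η := hu.comp_continuous continuous_subtype_val
  rw [QuotientGroup.eq]
  refine ⟨⟨η, hη⟩, fun σ => Subtype.ext (MonoidHom.ext fun q => ?_)⟩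
  change ((z.1 σ).1 q)⁻¹ * (z'.1 σ).1 q = η (MulAut.conjNormal (r σ)⁻¹ q) / η q
  have h2 : η (MulAut.conjNormal (r σ)⁻¹ q) = u ((r σ)⁻¹ * q * r σ) := by
    change u _ = _
    rw [MulAut.conjNormal_apply, inv_inv]
  have h3 : r σ * ((r σ)⁻¹ * q * r σ) = q * r σ := by group
  rw [hz, hz', hu' q, hu' (r σ), h2, h3]
  change _ = _ / u q
  generalize u ((r σ)⁻¹ * q * r σ) = a1
  generalize u q = a2
  generalize u (r σ) = a3
  generalize u (q * r σ) = a4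
  generalize c'.1 (q, r σ) = a5
  generalize c'.1 (r σ, (r σ)⁻¹ * q * r σ) = a6
  rw [inv_mul_eq_iff_eq_mul, mul_div_mul_comm, div_div_div_cancel_right, mul_comm a2 a3,
    mul_div_mul_left_eq_div, mul_assoc, div_mul_div_cancel, div_self', mul_one]

/-- Inflation along the quotient by a normal subgroup `P` is injective on `H²` if there are no
nontrivial continuous homomorphisms from `P` to the coefficients. -/
theorem H2.pullback_mk_injective (P : Subgroup Γ) [P.Normal]
    (hP : ∀ χ : P →* A, IsLocallyConstant χ → χ = 1) :
    Function.Injective (H2.pullback A (QuotientGroup.mk' P) continuous_quotient_mk') := by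
  rw [injective_iff_map_eq_one]
  intro α hα
  obtain ⟨c, rfl⟩ := QuotientGroup.mk_surjective α
  replace hα : (QuotientGroup.mk (Z2.pullback A (QuotientGroup.mk' P) continuous_quotient_mk' c) :
    H2 Γ A) = 1 := hα
  rw [QuotientGroup.eq_one_iff] at hα ⊢
  obtain ⟨u, hu, hu'⟩ := hα
  replace hu' (σ τ : Γ) : c.1 (σ, τ) = u σ * u τ / u (σ * τ) := hu' σ τ
  -- The cocycle need not be normalized, so the constant `c(1, 1)` has to be divided out before `u`
  -- becomes a homomorphism on `P`.
  have hc1 (σ : Γ ⧸ P) : c.1 (1, σ) = c.1 (1, 1) := by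
    have h1 := c.2.2 1 1 σ
    rwa [one_mul, one_mul, mul_right_inj] at h1
  have hPu (x : P) (σ : Γ) : u (x * σ) = u x / c.1 (1, 1) * u σ := by
    have h1 := hu' x σ
    rw [(QuotientGroup.eq_one_iff (x : Γ)).2 x.2, hc1, eq_div_iff_mul_eq', mul_comm] at h1
    rw [div_mul_eq_mul_div, ← h1, mul_div_cancel_right]
  let χ : P →* A := MonoidHom.mk' (fun x => u x / c.1 (1, 1)) fun x y => by
    rw [Subgroup.coe_mul, hPu, mul_div_assoc]
  have hχ : χ = 1 := hP χ ((hu.comp_continuous continuous_subtype_val).div (IsLocallyConstant.const _))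
  have hux (x : P) (σ : Γ) : u (x * σ) = u σ := by
    rw [hPu, show u x / c.1 (1, 1) = 1 from DFunLike.congr_fun hχ x, one_mul]
  -- The invariance of `u` is under left translation by `P`, whereas the quotient uses `σ⁻¹τ ∈ P`;
  -- normality of `P` passes between the two.
  have hv (σ τ : Γ) (h : (QuotientGroup.leftRel P) σ τ) : u σ = u τ := by
    rw [QuotientGroup.leftRel_apply] at h
    have h1 : τ * σ⁻¹ ∈ P := by
      have h2 := Subgroup.Normal.conj_mem ‹P.Normal› _ h σ
      rwa [mul_inv_cancel_left] at h2
    have h2 := hux ⟨_, h1⟩ σ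
    rw [inv_mul_cancel_right] at h2
    exact h2.symm
  let v : Γ ⧸ P → A := fun x => Quotient.lift u hv x
  refine ⟨v, fun s => ?_, fun σ τ => ?_⟩
  · exact isOpen_coinduced.2 (hu s)
  · obtain ⟨σ, rfl⟩ := QuotientGroup.mk_surjective σ
    obtain ⟨τ, rfl⟩ := QuotientGroup.mk_surjective τ
    exact hu' σ τ

end EdgeMap

/-! ### Wild inertia and the residue of the obstruction -/

section Wild

open IsLocalRing

variable (O k K : Type*) [CommRing O] [IsDomain O] [IsDiscreteValuationRing O]
  [HenselianLocalRing O] [Field k] [Algebra O k] [IsFractionRing O k] [Field K] [Algebra k K]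
  [Algebra O K] [IsScalarTower O k K] [IsSepClosure k K]

variable {O k K} in
/-- A wild automorphism fixes an element if some power of it, with exponent invertible in the residue
field, does so. -/
theorem apply_eq_self_of_mem_wildInertia {σ : Gal(K/k)} (hσ : σ ∈ wildInertia O k K) {n : ℕ}
    (hn : (n : ResidueField O) ≠ 0) {x : K} (hx : (σ ^ n) x = x) : σ x = x := by
  have hunit : IsUnit (n : SepInt O k K) := by
    have h1 : IsUnit (n : O) := by
      rw [← residue_ne_zero_iff_isUnit, map_natCast]
      exact hn
    simpa using h1.map (algebraMap O (SepInt O k K))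
  have hn0 : (n : K) ≠ 0 := by
    simpa using (hunit.map (algebraMap (SepInt O k K) K)).ne_zero
  -- Averaging over the powers of `σ`: the claim is that `x` equals the `σ`-invariant element `T /
  -- n`.
  let T : K := ∑ i ∈ Finset.range n, (σ ^ i) x
  have hT : σ T = T := by
    have h1 : σ T = ∑ i ∈ Finset.range n, (σ ^ (i + 1)) x := by
      simp only [T, map_sum, pow_succ', AlgEquiv.mul_apply]
    have h2 := Finset.sum_range_succ (fun i => (σ ^ i) x) n
    rw [Finset.sum_range_succ', pow_zero, AlgEquiv.one_apply, hx, add_left_inj] at h2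
    rw [h1, h2]
  have hTi (i : ℕ) : (σ ^ i) T = T := by
    induction i with
    | zero => rfl
    | succ i ih => rw [pow_succ, AlgEquiv.mul_apply, hT, ih]
  let y : K := x - T / n
  have hy : ∑ i ∈ Finset.range n, (σ ^ i) y = 0 := by
    simp only [y, map_sub, map_div₀, hTi, map_natCast, Finset.sum_sub_distrib, Finset.sum_const,
      Finset.card_range, nsmul_eq_mul]
    rw [mul_div_cancel₀ _ hn0]
    exact sub_self _
  -- Wildness turns the vanishing sum of the `(σ ^ i) y` into `y` times `n + ∑ w i`, a unit plus
  -- elements of the maximal ideal; hence `y = 0`.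
  choose w hw hw' using fun i => (wildInertia O k K).pow_mem hσ i y
  have h1 : y * algebraMap (SepInt O k K) K (n + ∑ i ∈ Finset.range n, w i) = 0 := by
    rw [← hy, Finset.sum_congr rfl fun i _ => hw' i, ← Finset.mul_sum]
    simp [Finset.sum_add_distrib]
  have h2 : IsUnit (n + ∑ i ∈ Finset.range n, w i) := by
    by_contra h
    have h3 := Ideal.sub_mem _ ((mem_maximalIdeal _).2 h)
      (Ideal.sum_mem (maximalIdeal (SepInt O k K)) (fun i (_ : i ∈ Finset.range n) => hw i))
    rw [add_sub_cancel_right] at h3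
    exact (mem_maximalIdeal _).1 h3 hunit
  have h4 : y = 0 :=
    (mul_eq_zero.1 h1).resolve_right (h2.map (algebraMap (SepInt O k K) K)).ne_zero
  rw [sub_eq_zero] at h4
  rw [h4, map_div₀, hT, map_natCast]

/-- There are no nontrivial continuous homomorphisms from the wild inertia group to a finite group of
order invertible in the residue field. -/
theorem wildInertia_hom_eq_one {A : Type*} [CommGroup A] [Finite A]
    (hA : (Nat.card A : ResidueField O) ≠ 0) (χ : wildInertia O k K →* A)
    (hχ : IsLocallyConstant χ) : χ = 1 := by
  have : IsGalois k K := inferInstance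
  have hopen : IsOpen ((χ.ker : Subgroup (wildInertia O k K)) : Set (wildInertia O k K)) :=
    hχ.isOpen_fiber 1
  obtain ⟨V, hV, hVχ⟩ := isOpen_induced_iff.1 hopen
  have h1V : (1 : Gal(K/k)) ∈ V := by
    have h1 : (1 : wildInertia O k K) ∈ Subtype.val ⁻¹' V := by
      rw [hVχ]
      exact one_mem _
    exact h1
  -- By continuity, `χ` is trivial on the wild elements that fix a suitable finite normal extension
  -- `L` of `k`.
  obtain ⟨L, hL⟩ := (krullTopology_mem_nhds_one_iff_of_normal k K V).1 (hV.mem_nhds h1V)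
  obtain ⟨hLf, hLn, hLV⟩ := hL
  have hker (x : wildInertia O k K)
      (hx : AlgEquiv.restrictNormalHom L (x : Gal(K/k)) = 1) : χ x = 1 := by
    have h1 : (x : Gal(K/k)) ∈ L.fixingSubgroup := by
      rw [← IntermediateField.restrictNormalHom_ker]
      exact hx
    have h2 : x ∈ Subtype.val ⁻¹' V := hLV h1
    rw [hVχ] at h2
    exact h2
  ext x
  let y : Gal(L/k) := AlgEquiv.restrictNormalHom L (x : Gal(K/k))
  have hyx (σ : Gal(K/k)) (a : L) : (AlgEquiv.restrictNormalHom L σ a : K) = σ a :=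
    AlgEquiv.restrictNormal_commutes σ L a
  -- A common prime `l` would be invertible in the residue field. With `d` the order of `y` divided
  -- by `l`, the `l`-th power of the wild element `x ^ d` fixes `L`, so `x ^ d` already fixes `L`,
  -- against the minimality of the order.
  have hcop : (orderOf y).Coprime (Nat.card A) := by
    refine Nat.coprime_of_dvd fun l hl hly hlA => ?_
    have hl0 : (l : ResidueField O) ≠ 0 := by
      obtain ⟨m, hm⟩ := hlA
      rw [hm, Nat.cast_mul] at hA
      exact left_ne_zero_of_mul hA
    obtain ⟨d, hd⟩ := hly
    have hd0 : 0 < d := Nat.pos_of_ne_zero fun h => (orderOf_pos y).ne' (by rw [hd, h, mul_zero])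
    have hyd : y ^ d = 1 := by
      ext a
      rw [← map_pow, hyx]
      refine apply_eq_self_of_mem_wildInertia ((wildInertia O k K).pow_mem x.2 d) hl0 ?_
      rw [← pow_mul, mul_comm, ← hd, ← hyx, map_pow, pow_orderOf_eq_one]
      rfl
    have hle := orderOf_le_of_pow_eq_one hd0 hyd
    have hlt := Nat.mul_lt_mul_of_pos_right hl.one_lt hd0
    omega
  have h1 : χ x ^ orderOf y = 1 := by
    rw [← map_pow]
    refine hker _ ?_
    rw [Subgroup.coe_pow, map_pow]
    exact pow_orderOf_eq_one y
  exact orderOf_eq_one_iff.1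
    (Nat.eq_one_of_dvd_coprimes hcop (orderOf_dvd_of_pow_eq_one h1) (orderOf_dvd_natCard _))

/-- Injectivity of inflation determines the class on the tame quotient, and that class determines
its image under the edge map. -/
theorem IsResidue.unique {A : Type*} [CommGroup A] [Finite A]
    (hA : (Nat.card A : ResidueField O) ≠ 0) {r : ResGal O k K →* TameGal O k K}
    {ω : H2 (Gal(K/k)) A} {β β' : H1 (twistAction A r)} (h : IsResidue r ω β)
    (h' : IsResidue r ω β') : β = β' := by
  obtain ⟨α, hα, hβ⟩ := h
  obtain ⟨α', hα', hβ'⟩ := h'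
  obtain rfl : α = α' := H2.pullback_mk_injective (wildInertia O k K)
    (wildInertia_hom_eq_one O k K hA) (hα.trans hα'.symm)
  exact hβ.unique hβ'

/-- The residue of the obstruction to lifting `φ : Γ_k → G/C` is trivial if the order of `φ(q₀)` is
prime to the order of `C`. -/
theorem isResidue_liftingObstruction_one {G : Type*} [Group G]
    (φ : Gal(K/k) →* G ⧸ Subgroup.center G) (hφ : IsLocallyConstant φ)
    (htame : wildInertia O k K ≤ φ.ker) (r : ResGal O k K →* TameGal O k K) (q₀ : TameGal O k K)
    (hq₀ : tameInertia O k K ≤ (Subgroup.zpowers q₀).topologicalClosure)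
    (hord : (orderOf (QuotientGroup.lift (wildInertia O k K) φ htame q₀)).Coprime
      (Nat.card (Subgroup.center G))) :
    IsResidue r (liftingObstruction φ hφ) 1 := by
  let ψ : TameGal O k K →* G ⧸ Subgroup.center G := QuotientGroup.lift _ φ htame
  have hψ : IsLocallyConstant ψ := fun S => isOpen_coinduced.2 (hφ S)
  -- Inflating the lifting cocycle of `ψ` gives that of `φ` on the nose, since the representatives
  -- depend only on values in `G/C`.
  refine ⟨liftingObstruction ψ hψ, rfl,
    isEdge_liftingObstruction_one _ r ψ hψ (ψ q₀) hord fun q hq => ?_⟩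
  -- As `ψ` is locally constant, this preimage is closed; it contains `q₀`, hence all of tame
  -- inertia.
  have hclosed : IsClosed (((Subgroup.zpowers (ψ q₀)).comap ψ : Subgroup (TameGal O k K)) :
      Set (TameGal O k K)) := ⟨hψ (Subgroup.zpowers (ψ q₀) : Set (G ⧸ Subgroup.center G))ᶜ⟩
  refine Subgroup.topologicalClosure_minimal _ ?_ hclosed (hq₀ hq)
  rw [Subgroup.zpowers_le]
  exact Subgroup.mem_zpowers (ψ q₀)

end Wild

end TameCover

end

/-! ### The vanishing of the residue -/

theorem mainTheorem9
    -- the field `k` of characteristic zero, henselian for a discrete valuation with ring `O`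
    {O k : Type*} [CommRing O] [IsDomain O] [IsDiscreteValuationRing O] [HenselianLocalRing O]
    [PerfectField (IsLocalRing.ResidueField O)]
    [Field k] [CharZero k] [Algebra O k] [IsFractionRing O k]
    -- a separable closure `K` of `k`, and an algebraic closure `Ω` of `k(z)` containing `K`
    {K Ω : Type*} [Field K] [Algebra k K] [Algebra O K] [IsScalarTower O k K] [IsSepClosure k K]
    [Field Ω] [Algebra (RatFunc k) Ω] [IsAlgClosure (RatFunc k) Ω] [Algebra K Ω] [Algebra k Ω]
    [IsScalarTower k K Ω] [IsScalarTower k (RatFunc k) Ω]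
    -- the `G`-cover `f` with field of moduli `k`, and a section `s` of `π₁(U_k) → Γ_k`
    {G : Type*} [Group G] [Finite G] (f : TameCover.GCover k K Ω G)
    (hS : f.HasInvariantBranchLocus)
    (s : Gal(K/k) →* f.ArithPi) (hs : Continuous s) (hs' : ∀ σ, f.proj (s σ) = σ)
    (hf : f.IsFieldOfModuli s)
    -- the order of `C` is prime to the residue characteristic, and `φ̄` is tamely ramified
    (hC : (Nat.card (Subgroup.center G) : IsLocalRing.ResidueField O) ≠ 0)
    (htame : TameCover.wildInertia O k K ≤ (TameCover.GCover.phibar hf).ker)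
    -- a section `r` of `Γ_kᵗ → Γ_{k₀}` and a topological generator `q₀` of `Iᵗ`
    (r : TameCover.ResGal O k K →* TameCover.TameGal O k K) (hr : Continuous r)
    (hr' : ∀ σ, TameCover.tameReduction O k K (r σ) = σ)
    (q₀ : TameCover.TameGal O k K)
    (hq₀ : (Subgroup.zpowers q₀).topologicalClosure = TameCover.tameInertia O k K)
    -- the order of `φ̄(q₀)` is prime to the order of `C`
    (hord : (orderOf (QuotientGroup.lift (TameCover.wildInertia O k K)
      (TameCover.GCover.phibar hf) htame q₀)).Coprime (Nat.card (Subgroup.center G))) :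
    (∃! β, TameCover.IsResidue r (TameCover.GCover.obstruction hs hf) β) ∧
      TameCover.residueMap r (TameCover.GCover.obstruction hs hf) = 1 := by
  have h1 : TameCover.IsResidue r (TameCover.GCover.obstruction hs hf) 1 :=
    TameCover.isResidue_liftingObstruction_one O k K _ _ htame r q₀ hq₀.ge hord
  -- Once some residue exists, the value selected by choice is a residue too, and uniqueness
  -- identifies it with `1`.
  have h2 : TameCover.IsResidue r (TameCover.GCover.obstruction hs hf)
      (TameCover.residueMap r (TameCover.GCover.obstruction hs hf)) :=
    Classical.epsilon_spec ⟨1, h1⟩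
  exact ⟨⟨1, h1, fun _ h => h.unique O k K hC h1⟩, h2.unique O k K hC h1⟩
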